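/- Let $q>4$ be a prime power and let $n\ge 1$. For $c\in\mathbb{F}_q^{2n}$ let $\mathrm{wt}(c)$ be the number of non-zero coordinates of $c$. Let $\mathcal{C}\subseteq\mathbb{F}_q^{2n}$ be a linear code (a linear subspace) with weight enumerator $$w_{\mathcal C}(x,y)=\sum_{c\in\mathcal C}x^{2n-\mathrm{wt}(c)}y^{\mathrm{wt}(c)}\in\mathbb{C}[x,y].$$ Suppose that $\mathcal C$ is formally self-dual, i.e. $$w_{\mathcal C}\!\left(\frac{x+(q-1)y}{\sqrt q},\frac{x-y}{\sqrt q}\right)=w_{\mathcal C}(x,y),$$ and divisible, i.e. there is an integer $m>1$ that divides $\mathrm{wt}(c)$ for every $c\in\mathcal C$. Then $\mathcal C$ is equivalent to the direct sum $$\bigoplus_{i=1}^{n}\langle(1,1)\rangle_{\mathbb{F}_q}=\{(a_1,a_1,a_2,a_2,\dots,a_n,a_n) : a_1,\dots,a_n\in\mathbb{F}_q\}$$ of $n$ copies of $\langle(1,1)\rangle_{\mathbb{F}_q}$; that is, the latter is the image of $\mathcal C$ under a monomial transformation $v\mapsto DPv$ of $\mathbb{F}_q^{2n}$, where $D$ is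 an invertible diagonal matrix and $P$ is a permutation matrix. -/

import Mathlib

open MvPolynomial

noncomputable section

namespace LinearCodes

/-- A linear code of length `N` over `F`: a linear subspace of `F ^ N`. -/
abbrev Code (F : Type*) [Field F] (N : ℕ) := Submodule F (Fin N → F)

section Weights

variable {F : Type*} [Field F] [DecidableEq F] {N : ℕ}

open Classical in
/-- The weight enumerator `∑_{c ∈ C} x ^ (N - wt c) * y ^ (wt c)`, with complex coefficients;
the variables are `x = X 0` and `y = X 1`. -/
def weightEnumerator [Fintype F] (C : Code F N) : MvPolynomial (Fin 2) ℂ :=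
  ∑ c : Fin N → F with c ∈ C, X 0 ^ (N - hammingNorm c) * X 1 ^ hammingNorm c

/-- All weights of codewords are divisible by `m`. -/
def IsDivisibleBy (C : Code F N) (m : ℕ) : Prop :=
  ∀ c ∈ C, m ∣ hammingNorm c

/-- The code is divisible by some `m > 1`. -/
def IsDivisible (C : Code F N) : Prop :=
  ∃ m : ℕ, 1 < m ∧ IsDivisibleBy C m

end Weights

/-- The right action of `GL₂(ℂ)` on `ℂ[x, y]`: for `g` with rows `(a, b)` and `(c, d)` this is
`p (a x + b y, c x + d y)`. -/
def act (p : MvPolynomial (Fin 2) ℂ) (g : GL (Fin 2) ℂ) : MvPolynomial (Fin 2) ℂ :=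
  aeval (fun i => ∑ j, C (g.val i j) * X j) p

/-- The symmetries of `p`: its stabilizer in `GL₂(ℂ)`. -/
def symmetries (p : MvPolynomial (Fin 2) ℂ) : Set (GL (Fin 2) ℂ) :=
  {g | act p g = p}

/-- The matrix `q ^ (-1/2) * [1, q - 1; 1, -1]`. -/
def macWilliamsMatrix (q : ℕ) : Matrix (Fin 2) (Fin 2) ℂ :=
  ((Real.sqrt q : ℝ) : ℂ)⁻¹ • !![1, (q : ℂ) - 1; 1, -1]

theorem det_macWilliamsMatrix_ne_zero {q : ℕ} (hq : q ≠ 0) :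
    (macWilliamsMatrix q).det ≠ 0 := by
  have h : ((Real.sqrt q : ℝ) : ℂ) ≠ 0 := by
    rw [Complex.ofReal_ne_zero]
    positivity
  have h' : (q : ℂ) ≠ 0 := by exact_mod_cast hq
  rw [macWilliamsMatrix, Matrix.det_smul, Matrix.det_fin_two_of]
  refine mul_ne_zero (pow_ne_zero _ (inv_ne_zero h)) ?_
  intro h0
  apply h'
  linear_combination -h0

/-- `macWilliamsMatrix q` as an element of `GL₂(ℂ)`. -/
def macWilliamsGL (q : ℕ) (hq : q ≠ 0) : GL (Fin 2) ℂ :=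
  Matrix.GeneralLinearGroup.mkOfDetNeZero (macWilliamsMatrix q) (det_macWilliamsMatrix_ne_zero hq)

/-- A code over `𝔽_q` is formally self-dual if `q ^ (-1/2) * [1, q - 1; 1, -1]` is a symmetry of
its weight enumerator. -/
def IsFormallySelfDual {F : Type*} [Field F] [DecidableEq F] [Fintype F] {N : ℕ}
    (C : Code F N) : Prop :=
  macWilliamsGL (Fintype.card F) Fintype.card_ne_zero ∈ symmetries (weightEnumerator C)

section Equivalence

variable {F : Type*} [Field F]

/-- The monomial transformation `v ↦ D P v`, where `D` is the diagonal matrix with non-zero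
entries `d` and `P` is the permutation matrix of `σ`. -/
def monomialMap {N : ℕ} (d : Fin N → Fˣ) (σ : Equiv.Perm (Fin N)) :
    (Fin N → F) →ₗ[F] (Fin N → F) :=
  Matrix.mulVecLin (Matrix.diagonal (fun i => (d i : F)) * σ.permMatrix F)

/-- Two codes are equivalent if one is the image of the other under a monomial transformation. -/
def IsEquivalent {N : ℕ} (C D : Code F N) : Prop :=
  ∃ (d : Fin N → Fˣ) (σ : Equiv.Perm (Fin N)), D = Submodule.map (monomialMap d σ) C

/-- The positions `k * i, …, k * i + k - 1` of the `i`-th block of length `k`. -/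
def block (k n : ℕ) (i : Fin n) (j : Fin k) : Fin (k * n) :=
  ⟨k * i + j, calc
    k * (i : ℕ) + j < k * i + k := Nat.add_lt_add_left j.isLt _
    _ = k * (i + 1) := (Nat.mul_succ _ _).symm
    _ ≤ k * n := Nat.mul_le_mul_left _ i.isLt⟩

/-- The direct sum of `n` copies of `C`, embedded blockwise in `F ^ (k * n)`: the vectors each of
whose `n` consecutive blocks of length `k` is a codeword of `C`. -/
def directSumCopies {k : ℕ} (C : Code F k) (n : ℕ) : Code F (k * n) :=
  ⨅ i : Fin n, Submodule.comap (LinearMap.funLeft F F (block k n i)) C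

variable (F) in
/-- The code of length two spanned by `(1, 1)`. -/
def repetitionTwo : Code F 2 :=
  Submodule.span F {![1, 1]}

end Equivalence

end LinearCodes

end

/-!
The MacWilliams matrix `M` fixes the weight enumerator `w`, and so does `diag(1, ζ)` when the
weights are divisible by `m` and `ζ ^ m = 1`. Hence `A = M * diag(1, ζ)` permutes the finitely many
zeros of `w` on the projective line, and each zero is an eigenvector of a power of `A`. If it were
not an eigenvector of `A`, the ratio `u` of the eigenvalues of `A` would be a root of unity with
`q * (2 + u + u⁻¹) = 2 - ζ - ζ⁻¹`. The algebraic integer `2 + u + u⁻¹` vanishes or has a conjugate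
of absolute value at least `1`, which for `q > 4` leaves only `ζ = 1`. Thus for `ζ ≠ 1` all zeros of
`w` are eigenvectors of both `M * diag(1, ζ)` and `M * diag(1, ζ⁻¹)`, whence `ζ = -1` and
`w = (x ^ 2 + (q - 1) * y ^ 2) ^ n`.

So `C` is even and has `n * (q - 1)` words of weight two. Evenness forces all codewords to be
proportional to a word of weight two on its support, so at most `q - 1` words of weight two are
nonzero at a given position. Counting shows that this bound is attained everywhere: the words of
weight two pair up the positions.
-/

open scoped Polynomial LinearAlgebra.Projectivization

theorem eq_one_of_isOfFinOrder_of_numberField {K : Type*} [Field K] [NumberField K] {q : ℕ}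
    (hq : 4 < q) {z w : K} (hz : IsOfFinOrder z) (hw : IsOfFinOrder w)
    (h : q * (2 + w + w⁻¹) = 2 - z - z⁻¹) : z = 1 := by
  have hintegral : IsIntegral ℤ (2 + w + w⁻¹) := by
    obtain ⟨k, hk, hwk⟩ := isOfFinOrder_iff_pow_eq_one.1 hw
    have hw_int : IsIntegral ℤ w := .of_pow hk (hwk ▸ isIntegral_one)
    have hw_inv_int : IsIntegral ℤ w⁻¹ := .of_pow hk (by simpa [hwk] using isIntegral_one)
    have htwo : IsIntegral ℤ (2 : K) :=
      one_add_one_eq_two (R := K) ▸ isIntegral_one.add isIntegral_one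
    exact (htwo.add hw_int).add hw_inv_int
  have hzero : 2 + w + w⁻¹ = 0 := by
    by_contra hne
    obtain ⟨σ, hσ⟩ : ∃ σ : K →+* ℂ, 1 ≤ ‖σ (2 + w + w⁻¹)‖ :=
      NumberField.exists_conjugate_one_le_norm (α := ⟨_, hintegral⟩)
        fun h0 => hne (congrArg Subtype.val h0)
    have hσz : ‖σ z‖ = 1 := ((σ : K →* ℂ).isOfFinOrder hz).norm_eq_one
    have : (q : ℝ) ≤ 4 := calc
      (q : ℝ) ≤ q * ‖σ (2 + w + w⁻¹)‖ := le_mul_of_one_le_right q.cast_nonneg hσ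
      _ = ‖σ (q * (2 + w + w⁻¹))‖ := by rw [map_mul, norm_mul, map_natCast, Complex.norm_natCast]
      _ = ‖2 - σ z - (σ z)⁻¹‖ := by simp only [h, map_sub, map_inv₀, map_ofNat]
      _ ≤ ‖(2 : ℂ)‖ + ‖σ z‖ + ‖(σ z)⁻¹‖ :=
        (norm_sub_le _ _).trans (by gcongr; exact norm_sub_le _ _)
      _ = 4 := by rw [norm_inv, hσz]; norm_num
    exact this.not_gt (by exact_mod_cast hq)
  have hz0 : z ≠ 0 := hz.isUnit.ne_zero
  rw [hzero, mul_zero] at h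
  have hsq : (z - 1) ^ 2 = 0 := by
    field_simp at h
    linear_combination h
  exact sub_eq_zero.1 (pow_eq_zero_iff two_ne_zero |>.1 hsq)

theorem eq_one_of_isOfFinOrder {L : Type*} [Field L] [CharZero L] {q : ℕ} (hq : 4 < q) {z w : L}
    (hz : IsOfFinOrder z) (hw : IsOfFinOrder w) (h : q * (2 + w + w⁻¹) = 2 - z - z⁻¹) :
    z = 1 := by
  have isIntegral {x : L} (hx : IsOfFinOrder x) : IsIntegral ℚ x :=
    let ⟨_, hk, hxk⟩ := isOfFinOrder_iff_pow_eq_one.1 hx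
    .of_pow hk (hxk ▸ isIntegral_one)
  let K := IntermediateField.adjoin ℚ {z, w}
  have : FiniteDimensional ℚ K := IntermediateField.finiteDimensional_adjoin <| by
    rintro x (rfl | rfl)
    exacts [isIntegral hz, isIntegral hw]
  have : NumberField K := { }
  let z' : K := ⟨z, IntermediateField.subset_adjoin ℚ _ (by simp)⟩
  let w' : K := ⟨w, IntermediateField.subset_adjoin ℚ _ (by simp)⟩
  have isOfFinOrder {x : K} (hx : IsOfFinOrder (x : L)) : IsOfFinOrder x := by
    rw [isOfFinOrder_iff_pow_eq_one] at hx ⊢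
    exact_mod_cast hx
  exact congrArg Subtype.val <| eq_one_of_isOfFinOrder_of_numberField hq
    (isOfFinOrder (x := z') hz) (isOfFinOrder (x := w') hw) (Subtype.ext h)

theorem hasEigenvector_of_pow {R M : Type*} [CommRing R] [IsDomain R] [AddCommGroup M]
    [Module R M] [Module.IsTorsionFree R M] {f : Module.End R M} {a b c : R}
    (hf : Polynomial.aeval f
      ((Polynomial.X - Polynomial.C a) * (Polynomial.X - Polynomial.C b)) = 0)
    {k : ℕ} (hab : a ^ k ≠ b ^ k) {v : M} (hv : (f ^ k).HasEigenvector c v) :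
    f.HasEigenvector a v ∨ f.HasEigenvector b v := by
  -- `f v - y • v` is an eigenvector both of `f`, for `x`, and of `f ^ k`, for `c`.
  have pow_eq {x y : R} (hxy : Polynomial.aeval f
      ((Polynomial.X - Polynomial.C x) * (Polynomial.X - Polynomial.C y)) = 0)
      (hvy : f v ≠ y • v) : c = x ^ k := by
    have hw : f.HasEigenvector x (f v - y • v) := by
      refine ⟨Module.End.mem_eigenspace_iff.2 ?_, sub_ne_zero.2 hvy⟩
      simpa [sub_eq_zero] using congr($hxy v)
    have hwk : (f ^ k) (f v - y • v) = c • (f v - y • v) := by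
      rw [map_sub, map_smul, ← Module.End.mul_apply, ← pow_succ, pow_succ', Module.End.mul_apply,
        hv.apply_eq_smul, map_smul, smul_sub, smul_comm]
    exact smul_left_injective R hw.2 (hwk.symm.trans (hw.pow_apply k))
  by_contra! h
  have hva : f v ≠ a • v := fun hva => h.1 ⟨Module.End.mem_eigenspace_iff.2 hva, hv.2⟩
  have hvb : f v ≠ b • v := fun hvb => h.2 ⟨Module.End.mem_eigenspace_iff.2 hvb, hv.2⟩
  exact hab ((pow_eq hf hvb).symm.trans (pow_eq (mul_comm _ (_ - Polynomial.C b) ▸ hf) hva))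

theorem eval_smul_of_isHomogeneous {σ R : Type*} [CommSemiring R] {p : MvPolynomial σ R} {n : ℕ}
    (hp : p.IsHomogeneous n) (a : R) (v : σ → R) : eval (a • v) p = a ^ n * eval v p := by
  simp only [eval_eq, Finset.mul_sum]
  refine Finset.sum_congr rfl fun d hd => ?_
  have hdeg : ∑ i ∈ d.support, d i = n := by
    rw [← hp (mem_support_iff.1 hd)]
    simp [Finsupp.weight_apply, Finsupp.sum]
  simp only [Pi.smul_apply, smul_eq_mul, mul_pow, Finset.prod_mul_distrib,
    Finset.prod_pow_eq_pow_sum, hdeg]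
  ring

theorem finite_projective_zeros {K : Type*} [Field K] [Infinite K] {p : MvPolynomial (Fin 2) K}
    {n : ℕ} (hp : p.IsHomogeneous n) (hp0 : p ≠ 0) :
    {P : ℙ K (Fin 2 → K) | ∃ v hv, P = .mk K v hv ∧ eval v p = 0}.Finite := by
  let f : K[X] := aeval ![Polynomial.X, 1] p
  have eval_f (x : K) : f.eval x = eval ![x, 1] p := by
    rw [← Polynomial.coe_aeval_eq_eval, comp_aeval_apply, aeval_eq_eval]
    congr 2
    ext i
    fin_cases i <;> simp
  have eval_eq (v : Fin 2 → K) (hv : v 1 ≠ 0) : eval v p = v 1 ^ n * f.eval (v 0 / v 1) := by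
    rw [eval_f, ← eval_smul_of_isHomogeneous hp]
    congr 2
    ext i
    fin_cases i <;> simp [mul_div_cancel₀ _ hv]
  have hf : f ≠ 0 := by
    intro hf
    have : p * X 1 = 0 := funext fun v => by
      by_cases hv : v 1 = 0 <;> simp [eval_eq, hf, hv]
    simp_all
  let e (x : K) : ℙ K (Fin 2 → K) := .mk K ![x, 1] (by simp)
  let infinity : ℙ K (Fin 2 → K) := .mk K ![1, 0] (by simp)
  refine (((Polynomial.finite_setOfPred_isRoot hf).image e).insert infinity).subset ?_
  rintro _ ⟨v, hv, rfl, hpv⟩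
  by_cases hv1 : v 1 = 0
  · left
    refine (Projectivization.mk_eq_mk_iff' ..).2 ⟨v 0, ?_⟩
    ext i
    fin_cases i <;> simp [hv1]
  · right
    refine ⟨v 0 / v 1, ?_, (Projectivization.mk_eq_mk_iff' ..).2 ⟨(v 1)⁻¹, ?_⟩⟩
    · simpa [eval_eq v hv1, hv1] using hpv
    · ext i
      fin_cases i <;> simp [hv1, inv_mul_eq_div]

theorem exists_hasEigenvector_pow {K : Type*} [Field K] [Infinite K]
    {p : MvPolynomial (Fin 2) K} {n : ℕ} (hp : p.IsHomogeneous n) (hp0 : p ≠ 0)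
    {f : Module.End K (Fin 2 → K)} (hf : Function.Injective f)
    (hpf : ∀ v, eval v p = 0 → eval (f v) p = 0) {v : Fin 2 → K} (hv : v ≠ 0)
    (hpv : eval v p = 0) : ∃ k, 0 < k ∧ ∃ c, (f ^ k).HasEigenvector c v := by
  have pow_injective (k : ℕ) : Function.Injective (f ^ k) := by
    rw [Module.End.coe_pow]
    exact hf.iterate k
  have eval_pow_eq_zero (k : ℕ) : eval ((f ^ k) v) p = 0 := by
    induction k with
    | zero => exact hpv
    | succ k ih => exact pow_succ' f k ▸ hpf _ ih
  let P (k : ℕ) : ℙ K (Fin 2 → K) := .mk K _ ((map_ne_zero_iff _ (pow_injective k)).2 hv)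
  obtain ⟨i, j, hij, h⟩ := (finite_projective_zeros hp hp0).exists_lt_map_eq_of_forall_mem
    (f := P) fun k => Set.mem_ofPred.2 ⟨_, _, rfl, eval_pow_eq_zero k⟩
  obtain ⟨c, hc⟩ := (Projectivization.mk_eq_mk_iff' ..).1 h.symm
  refine ⟨j - i, Nat.sub_pos_of_lt hij, c, Module.End.mem_eigenspace_iff.2 ?_, hv⟩
  refine pow_injective i ?_
  rw [← Module.End.mul_apply, ← pow_add, Nat.add_sub_cancel' hij.le, map_smul, hc]

theorem exists_eq_one_add_C_mul_X_pow {K : Type*} [Field K] [IsAlgClosed K] {f : K[X]} {a : K}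
    (h0 : f.coeff 0 = 1) (hf : ∀ x, f.IsRoot x → 1 + a * x = 0) :
    ∃ d : ℕ, f = (1 + Polynomial.C a * Polynomial.X) ^ d := by
  rcases eq_or_ne a 0 with rfl | ha
  · refine ⟨0, ?_⟩
    have hdeg : f.degree = 0 := by
      by_contra hdeg
      obtain ⟨x, hx⟩ := IsAlgClosed.exists_root f hdeg
      simpa using hf x hx
    rw [Polynomial.eq_C_of_degree_eq_zero hdeg, h0, pow_zero, map_one]
  have hroots : f.roots = Multiset.replicate f.roots.card (-a⁻¹) := by
    refine Multiset.eq_replicate_card.2 fun x hx => ?_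
    have := hf x (Polynomial.isRoot_of_mem_roots hx)
    field_simp
    linear_combination this
  obtain ⟨b, d, rfl⟩ : ∃ b d, f = Polynomial.C b * (Polynomial.X + Polynomial.C a⁻¹) ^ d := by
    refine ⟨f.leadingCoeff, f.roots.card, ?_⟩
    conv_lhs => rw [(IsAlgClosed.splits f).eq_prod_roots, hroots]
    simp
  have hb : b = a ^ d := by
    simpa [Polynomial.coeff_zero_eq_eval_zero, mul_inv_eq_one₀, ha] using h0
  refine ⟨d, ?_⟩
  rw [hb, map_pow, ← mul_pow, mul_add, ← map_mul, mul_inv_cancel₀ ha, map_one, add_comm]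

theorem exists_eq_one_add_C_mul_X_pow_pow {K : Type*} [Field K] [IsAlgClosed K] {f : K[X]}
    {k : ℕ} (hk : 0 < k) {a : K} (h0 : f.coeff 0 = 1) (hdvd : ∀ i, f.coeff i ≠ 0 → k ∣ i)
    (hf : ∀ x, f.IsRoot x → 1 + a * x ^ k = 0) :
    ∃ d : ℕ, f = (1 + Polynomial.C a * Polynomial.X ^ k) ^ d := by
  obtain ⟨g, rfl⟩ : ∃ g : K[X], f = Polynomial.expand K k g := by
    refine ⟨Polynomial.contract k f, Polynomial.ext fun i => ?_⟩
    rw [Polynomial.coeff_expand hk]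
    split_ifs with hi
    · rw [Polynomial.coeff_contract hk.ne', Nat.div_mul_cancel hi]
    · exact not_imp_comm.1 (hdvd i) hi
  have hg0 : g.coeff 0 = 1 := by simpa [Polynomial.coeff_expand hk] using h0
  have hg (x : K) (hx : g.IsRoot x) : 1 + a * x = 0 := by
    obtain ⟨y, rfl⟩ := IsAlgClosed.exists_pow_nat_eq x hk
    exact hf y (by simpa [Polynomial.IsRoot] using hx)
  obtain ⟨d, rfl⟩ := exists_eq_one_add_C_mul_X_pow hg0 hg
  exact ⟨d, by simp⟩

theorem coeff_one_add_C_mul_X_pow_pow {R : Type*} [CommRing R] (a : R) {k : ℕ} (hk : 0 < k)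
    (d : ℕ) :
    ((1 + Polynomial.C a * Polynomial.X ^ k) ^ d).coeff k = d * a := by
  have hexpand : (1 + Polynomial.C a * Polynomial.X ^ k) ^ d =
      Polynomial.expand R k (((1 + Polynomial.X) ^ d).comp (Polynomial.C a * Polynomial.X)) := by
    simp
  rw [hexpand, Polynomial.coeff_expand hk, if_pos dvd_rfl, Nat.div_self hk,
    Polynomial.comp_C_mul_X_coeff, Polynomial.coeff_one_add_X_pow]
  simp

theorem exists_charpoly_eq_of_fin_two {K : Type*} [Field K] [IsAlgClosed K]
    (A : Matrix (Fin 2) (Fin 2) K) :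
    ∃ a b, a + b = A.trace ∧ a * b = A.det ∧
      A.charpoly = (Polynomial.X - Polynomial.C a) * (Polynomial.X - Polynomial.C b) := by
  obtain ⟨a, ha⟩ := IsAlgClosed.exists_root A.charpoly
    (by rw [Matrix.charpoly_degree_eq_dim]; simp)
  have hroot : a ^ 2 - A.trace * a + A.det = 0 := by
    simpa [Matrix.charpoly_fin_two] using ha
  have hdet : a * (A.trace - a) = A.det := by linear_combination -hroot
  refine ⟨a, A.trace - a, by ring, hdet, ?_⟩
  rw [Matrix.charpoly_fin_two, ← hdet, map_mul, map_sub]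
  ring

theorem ofReal_sqrt_natCast_sq (q : ℕ) : ((√(q : ℝ) : ℝ) : ℂ) ^ 2 = q := by
  rw [← Complex.ofReal_pow, Real.sq_sqrt q.cast_nonneg, Complex.ofReal_natCast]

theorem ofReal_sqrt_natCast_ne_zero {q : ℕ} (hq : q ≠ 0) : ((√(q : ℝ) : ℝ) : ℂ) ≠ 0 := by
  rw [Complex.ofReal_ne_zero]
  positivity

theorem isConj_of_sq_eq_one_of_forall_apply_ne {α : Type*} [Finite α]
    {σ τ : Equiv.Perm α} (hσ : σ ^ 2 = 1) (hτ : τ ^ 2 = 1) (hσ_ne : ∀ x, σ x ≠ x)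
    (hτ_ne : ∀ x, τ x ≠ x) : IsConj σ τ := by
  classical
  have := Fintype.ofFinite α
  have cycleType_eq {ρ : Equiv.Perm α} (hρ : ρ ^ 2 = 1) (hρ_ne : ∀ x, ρ x ≠ x) :
      ρ.cycleType = Multiset.replicate (Fintype.card α / 2) 2 := by
    have htype := Equiv.Perm.cycleType_of_pow_prime_eq_one (p := 2) hρ
    have hsupp : ρ.support = Finset.univ :=
      Finset.eq_univ_of_forall fun x => Equiv.Perm.mem_support.2 (hρ_ne x)
    have hcard : ρ.cycleType.card * 2 = Fintype.card α := by
      rw [← Finset.card_univ, ← hsupp, ← ρ.sum_cycleType, htype]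
      simp
    rw [htype, ← hcard, Nat.mul_div_cancel _ two_pos]
  rw [Equiv.Perm.isConj_iff_cycleType_eq, cycleType_eq hσ hσ_ne, cycleType_eq hτ hτ_ne]

theorem exists_ne_of_hammingNorm_eq_two {ι R : Type*} [Fintype ι] [DecidableEq R] [Zero R]
    {c : ι → R} (hc : hammingNorm c = 2) (i : ι) : ∃ j, j ≠ i ∧ c j ≠ 0 := by
  obtain ⟨j, hj, hji⟩ := Finset.exists_mem_ne (one_lt_two.trans_eq hc.symm) i
  exact ⟨j, hji, (Finset.mem_filter.1 hj).2⟩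

theorem eq_or_eq_of_hammingNorm_eq_two {ι R : Type*} [Fintype ι] [DecidableEq R] [Zero R]
    {c : ι → R} (hc : hammingNorm c = 2) {i j k : ι} (hij : i ≠ j) (hi : c i ≠ 0) (hj : c j ≠ 0)
    (hk : c k ≠ 0) : k = i ∨ k = j := by
  classical
  by_contra! h
  have hcard : ({k, i, j} : Finset ι).card ≤ hammingNorm c := by
    refine Finset.card_le_card fun l hl => ?_
    simp only [Finset.mem_insert, Finset.mem_singleton] at hl
    rcases hl with rfl | rfl | rfl <;> simpa
  rw [Finset.card_eq_three.2 ⟨k, i, j, h.1, h.2, hij, rfl⟩] at hcard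
  omega

namespace LinearCodes

open scoped Matrix

/-- The MacWilliams matrix composed with the symmetry `diag(1, ζ)` of the weight enumerators of
codes that are divisible by the order of `ζ`. -/
noncomputable def twistedMacWilliamsMatrix (q : ℕ) (ζ : ℂ) : Matrix (Fin 2) (Fin 2) ℂ :=
  macWilliamsMatrix q * Matrix.diagonal ![1, ζ]

theorem twistedMacWilliamsMatrix_eq (q : ℕ) (ζ : ℂ) :
    twistedMacWilliamsMatrix q ζ = ((√(q : ℝ) : ℝ) : ℂ)⁻¹ • !![1, (q - 1) * ζ; 1, -ζ] := by
  rw [twistedMacWilliamsMatrix, macWilliamsMatrix, Matrix.smul_mul]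
  congr 1
  ext i j
  fin_cases i <;> fin_cases j <;> simp

theorem trace_twistedMacWilliamsMatrix_sq {q : ℕ} (hq : q ≠ 0) (ζ : ℂ) :
    q * (twistedMacWilliamsMatrix q ζ).trace ^ 2 = (1 - ζ) ^ 2 := by
  have := ofReal_sqrt_natCast_ne_zero hq
  rw [← ofReal_sqrt_natCast_sq q, twistedMacWilliamsMatrix_eq, Matrix.trace_smul,
    Matrix.trace_fin_two_of, smul_eq_mul]
  field_simp
  ring

theorem det_twistedMacWilliamsMatrix {q : ℕ} (hq : q ≠ 0) (ζ : ℂ) :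
    (twistedMacWilliamsMatrix q ζ).det = -ζ := by
  have := ofReal_sqrt_natCast_ne_zero hq
  rw [twistedMacWilliamsMatrix_eq, Matrix.det_smul, Matrix.det_fin_two_of, Fintype.card_fin]
  field_simp
  linear_combination ζ * ofReal_sqrt_natCast_sq q

theorem pow_ne_pow_of_eigenvalues_twistedMacWilliamsMatrix {q : ℕ} (hq : 4 < q) {ζ : ℂ}
    (hζ : IsOfFinOrder ζ) (hζ1 : ζ ≠ 1) {a b : ℂ}
    (hadd : a + b = (twistedMacWilliamsMatrix q ζ).trace)
    (hmul : a * b = (twistedMacWilliamsMatrix q ζ).det) {k : ℕ} (hk : 0 < k) : a ^ k ≠ b ^ k := by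
  intro hab
  have hζ0 : ζ ≠ 0 := hζ.isUnit.ne_zero
  have hsq : q * (a + b) ^ 2 = (1 - ζ) ^ 2 := by
    rw [hadd, trace_twistedMacWilliamsMatrix_sq (by omega)]
  rw [det_twistedMacWilliamsMatrix (by omega)] at hmul
  obtain ⟨ha, hb⟩ : a ≠ 0 ∧ b ≠ 0 := mul_ne_zero_iff.1 (hmul ▸ neg_ne_zero.2 hζ0)
  have hratio : IsOfFinOrder (a / b) :=
    isOfFinOrder_iff_pow_eq_one.2 ⟨k, hk, by rw [div_pow, hab, div_self (pow_ne_zero _ hb)]⟩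
  refine hζ1 (eq_one_of_isOfFinOrder hq hζ hratio ?_)
  field_simp
  linear_combination ζ * hsq + (1 - ζ) ^ 2 * hmul

theorem eval_act (p : MvPolynomial (Fin 2) ℂ) (g : GL (Fin 2) ℂ) (v : Fin 2 → ℂ) :
    eval v (act p g) = eval (g.val *ᵥ v) p := by
  rw [act, ← coe_aeval_eq_eval, RingHom.coe_coe, comp_aeval_apply, aeval_eq_eval]
  congr 2
  ext i
  simp [Matrix.mulVec, dotProduct]

section WeightEnumerator

variable {F : Type*} [Field F] [Fintype F] [DecidableEq F] {N : ℕ}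

open Classical in
theorem eval_weightEnumerator (C : Code F N) (v : Fin 2 → ℂ) :
    eval v (weightEnumerator C) =
      ∑ c : Fin N → F with c ∈ C, v 0 ^ (N - hammingNorm c) * v 1 ^ hammingNorm c := by
  simp [weightEnumerator]

theorem isHomogeneous_weightEnumerator (C : Code F N) : (weightEnumerator C).IsHomogeneous N := by
  refine IsHomogeneous.sum _ _ _ fun c _ => ?_
  have hc : hammingNorm c ≤ N := by simpa using hammingNorm_le_card_fintype (x := c)
  simpa only [Nat.sub_add_cancel hc] using
    (isHomogeneous_X_pow (R := ℂ) (0 : Fin 2) (N - hammingNorm c)).mul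
      (isHomogeneous_X_pow 1 (hammingNorm c))

theorem eval_weightEnumerator_zero_right (C : Code F N) (x : ℂ) :
    eval ![x, 0] (weightEnumerator C) = x ^ N := by
  rw [eval_weightEnumerator, Finset.sum_eq_single 0]
  · simp
  · intro c _ hc
    simp [hc]
  · simp

theorem weightEnumerator_ne_zero (C : Code F N) : weightEnumerator C ≠ 0 := by
  intro h
  simpa [h] using eval_weightEnumerator_zero_right C 1

theorem IsFormallySelfDual.eval_macWilliamsMatrix_mulVec {C : Code F N}
    (hC : IsFormallySelfDual C) (v : Fin 2 → ℂ) :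
    eval (macWilliamsMatrix (Fintype.card F) *ᵥ v) (weightEnumerator C) =
      eval v (weightEnumerator C) :=
  (eval_act _ (macWilliamsGL _ Fintype.card_ne_zero) v).symm.trans congr(eval v $hC)

theorem IsDivisibleBy.eval_diagonal_mulVec {C : Code F N} {m : ℕ} (hC : IsDivisibleBy C m)
    {ζ : ℂ} (hζ : ζ ^ m = 1) (v : Fin 2 → ℂ) :
    eval (Matrix.diagonal ![1, ζ] *ᵥ v) (weightEnumerator C) = eval v (weightEnumerator C) := by
  classical
  rw [eval_weightEnumerator, eval_weightEnumerator]
  refine Finset.sum_congr rfl fun c hc => ?_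
  obtain ⟨k, hk⟩ := hC c (Finset.mem_filter.1 hc).2
  simp [Matrix.mulVec_diagonal, mul_pow, hk, pow_mul, hζ]

theorem exists_hasEigenvector_twistedMacWilliamsMatrix (hq : 4 < Fintype.card F)
    {C : Code F N} (hC : IsFormallySelfDual C) {m : ℕ} (hm : 0 < m) (hCm : IsDivisibleBy C m)
    {ζ : ℂ} (hζ : ζ ^ m = 1) (hζ1 : ζ ≠ 1) {v : Fin 2 → ℂ} (hv : v ≠ 0)
    (hvC : eval v (weightEnumerator C) = 0) :
    ∃ a, Module.End.HasEigenvector (twistedMacWilliamsMatrix (Fintype.card F) ζ).toLin' a v := by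
  set A := twistedMacWilliamsMatrix (Fintype.card F) ζ with hA_def
  have hζ_ord : IsOfFinOrder ζ := isOfFinOrder_iff_pow_eq_one.2 ⟨m, hm, hζ⟩
  have hA : Function.Injective A.toLin' := by
    refine Matrix.mulVec_injective_iff_isUnit.2 ((Matrix.isUnit_iff_isUnit_det A).2 ?_)
    rw [det_twistedMacWilliamsMatrix Fintype.card_ne_zero]
    exact hζ_ord.isUnit.neg
  have hAC (u : Fin 2 → ℂ) (hu : eval u (weightEnumerator C) = 0) :
      eval (A.toLin' u) (weightEnumerator C) = 0 := by
    rw [Matrix.toLin'_apply, hA_def, twistedMacWilliamsMatrix, ← Matrix.mulVec_mulVec,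
      hC.eval_macWilliamsMatrix_mulVec, hCm.eval_diagonal_mulVec hζ, hu]
  obtain ⟨k, hk, c, hc⟩ := exists_hasEigenvector_pow (isHomogeneous_weightEnumerator C)
    (weightEnumerator_ne_zero C) hA hAC hv hvC
  obtain ⟨a, b, hadd, hmul, hchar⟩ := exists_charpoly_eq_of_fin_two A
  have hab : a ^ k ≠ b ^ k :=
    pow_ne_pow_of_eigenvalues_twistedMacWilliamsMatrix hq hζ_ord hζ1 hadd hmul hk
  have haeval : Polynomial.aeval A.toLin'
      ((Polynomial.X - Polynomial.C a) * (Polynomial.X - Polynomial.C b)) = 0 := by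
    rw [← hchar, ← Matrix.charpoly_toLin']
    exact LinearMap.aeval_self_charpoly _
  rcases hasEigenvector_of_pow haeval hab hc with h | h
  exacts [⟨a, h⟩, ⟨b, h⟩]

theorem mul_apply_one_eq_of_eval_weightEnumerator_eq_zero (hq : 4 < Fintype.card F)
    {C : Code F N} (hC : IsFormallySelfDual C) {m : ℕ} (hm : 0 < m) (hCm : IsDivisibleBy C m)
    {ζ : ℂ} (hζ : ζ ^ m = 1) (hζ1 : ζ ≠ 1) {v : Fin 2 → ℂ} (hv : v ≠ 0)
    (hvC : eval v (weightEnumerator C) = 0) :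
    (v 0 + (Fintype.card F - 1) * (ζ * v 1)) * v 1 = (v 0 - ζ * v 1) * v 0 := by
  obtain ⟨a, ha⟩ := exists_hasEigenvector_twistedMacWilliamsMatrix hq hC hm hCm hζ hζ1 hv hvC
  have hs := inv_ne_zero (ofReal_sqrt_natCast_ne_zero (Fintype.card_ne_zero (α := F)))
  have h := ha.apply_eq_smul
  rw [Matrix.toLin'_apply, twistedMacWilliamsMatrix_eq, Matrix.smul_mulVec] at h
  have h0 := congrFun h 0
  have h1 := congrFun h 1
  simp only [Pi.smul_apply, smul_eq_mul, Matrix.mulVec, dotProduct, Fin.sum_univ_two,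
    Matrix.of_apply, Matrix.cons_val_zero, Matrix.cons_val_one] at h0 h1
  exact mul_left_cancel₀ hs (by linear_combination v 1 * h0 - v 0 * h1)

theorem eq_neg_one_and_sq_add_eq_zero_of_eval_weightEnumerator_eq_zero (hq : 4 < Fintype.card F)
    {C : Code F N} (hC : IsFormallySelfDual C) {m : ℕ} (hm : 0 < m) (hCm : IsDivisibleBy C m)
    {ζ : ℂ} (hζ : ζ ^ m = 1) (hζ1 : ζ ≠ 1) {v : Fin 2 → ℂ} (hv : v ≠ 0)
    (hvC : eval v (weightEnumerator C) = 0) :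
    ζ = -1 ∧ v 0 ^ 2 + (Fintype.card F - 1) * v 1 ^ 2 = 0 := by
  -- The relations obtained from `ζ` and from `ζ⁻¹` are compatible only if `ζ = ζ⁻¹`.
  have h := mul_apply_one_eq_of_eval_weightEnumerator_eq_zero hq hC hm hCm hζ hζ1 hv hvC
  have h' := mul_apply_one_eq_of_eval_weightEnumerator_eq_zero hq hC hm hCm (ζ := ζ⁻¹)
    (by rw [inv_pow, hζ, inv_one]) (inv_ne_one.2 hζ1) hv hvC
  have hζ0 : ζ ≠ 0 := by
    rintro rfl
    simp [hm.ne'] at hζ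
  have hv1 : v 1 ≠ 0 := by
    intro hv1
    have hv0 : v 0 = 0 := by simpa [hv1] using h
    exact hv (funext (Fin.forall_fin_two.2 ⟨hv0, hv1⟩))
  have hv01 : v 0 + (Fintype.card F - 1) * v 1 ≠ 0 := by
    intro hv01
    have : (Fintype.card F * (Fintype.card F - 1) : ℂ) * v 1 ^ 2 = 0 := by
      linear_combination -h + ((1 + ζ) * v 1 - v 0 + (Fintype.card F - 1) * v 1) * hv01
    refine mul_ne_zero (mul_ne_zero ?_ ?_) (pow_ne_zero 2 hv1) this
    · exact_mod_cast Fintype.card_ne_zero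
    · exact sub_ne_zero.2 (by exact_mod_cast (by omega : Fintype.card F ≠ 1))
  have hζ_eq : ζ = -1 := by
    refine (sq_eq_one_iff.1 ?_).resolve_left hζ1
    have : (ζ ^ 2 - 1) * (v 1 * (v 0 + (Fintype.card F - 1) * v 1)) = 0 := by
      field_simp at h'
      linear_combination ζ * h - h'
    exact sub_eq_zero.1 ((mul_eq_zero_iff_right (mul_ne_zero hv1 hv01)).1 this)
  refine ⟨hζ_eq, ?_⟩
  rw [hζ_eq] at h
  linear_combination -h

end WeightEnumerator

section WeightDistribution

variable {F : Type*} [Field F] [Fintype F] [DecidableEq F] {N : ℕ}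

open Classical in
/-- The codewords of weight `k`; their number is the entry `A_k` of the weight distribution. -/
noncomputable def wordsOfWeight (C : Code F N) (k : ℕ) : Finset (Fin N → F) :=
  {c | c ∈ C ∧ hammingNorm c = k}

theorem mem_wordsOfWeight {C : Code F N} {k : ℕ} {c : Fin N → F} :
    c ∈ wordsOfWeight C k ↔ c ∈ C ∧ hammingNorm c = k := by
  simp [wordsOfWeight]

theorem wordsOfWeight_zero (C : Code F N) : wordsOfWeight C 0 = {0} := by
  ext c
  simp +contextual [mem_wordsOfWeight]

/-- The weight enumerator dehomogenized at `x = 1`. -/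
noncomputable def weightPolynomial (C : Code F N) : ℂ[X] :=
  aeval ![1, Polynomial.X] (weightEnumerator C)

theorem eval_weightPolynomial (C : Code F N) (t : ℂ) :
    (weightPolynomial C).eval t = eval ![1, t] (weightEnumerator C) := by
  rw [weightPolynomial, ← Polynomial.coe_aeval_eq_eval, comp_aeval_apply, aeval_eq_eval]
  congr 2
  ext i
  fin_cases i <;> simp

theorem coeff_weightPolynomial (C : Code F N) (k : ℕ) :
    (weightPolynomial C).coeff k = (wordsOfWeight C k).card := by
  simp [weightPolynomial, weightEnumerator, wordsOfWeight, Polynomial.coeff_X_pow,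
    Finset.filter_filter, eq_comm (a := k)]

theorem coeff_zero_weightPolynomial (C : Code F N) : (weightPolynomial C).coeff 0 = 1 := by
  simp [coeff_weightPolynomial, wordsOfWeight_zero]

theorem exists_isRoot_weightPolynomial {C : Code F N} (hC : C ≠ ⊥) :
    ∃ t, (weightPolynomial C).IsRoot t := by
  obtain ⟨c, hc, hc0⟩ := C.ne_bot_iff.1 hC
  refine IsAlgClosed.exists_root _ fun hdeg => ?_
  have hcoeff : (weightPolynomial C).coeff (hammingNorm c) = 0 :=
    Polynomial.coeff_eq_zero_of_degree_lt (by simpa [hdeg, Nat.pos_iff_ne_zero] using hc0)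
  rw [coeff_weightPolynomial, Nat.cast_eq_zero, Finset.card_eq_zero] at hcoeff
  exact Finset.notMem_empty c (hcoeff ▸ mem_wordsOfWeight.2 ⟨hc, rfl⟩)

theorem eval_weightEnumerator_one (C : Code F N) :
    eval 1 (weightEnumerator C) = (Fintype.card F : ℂ) ^ Module.finrank F C := by
  classical
  have hcard := Module.card_eq_pow_finrank (K := F) (V := C)
  rw [Fintype.card_subtype] at hcard
  rw [eval_weightEnumerator, ← Nat.cast_pow, ← hcard]
  simp

theorem IsFormallySelfDual.two_mul_finrank_eq {C : Code F N} (hC : IsFormallySelfDual C) :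
    2 * Module.finrank F C = N := by
  have hs := ofReal_sqrt_natCast_sq (Fintype.card F)
  have hs0 := ofReal_sqrt_natCast_ne_zero (Fintype.card_ne_zero (α := F))
  have hmul : macWilliamsMatrix (Fintype.card F) *ᵥ 1 = ![(√(Fintype.card F : ℝ) : ℂ), 0] := by
    ext i
    fin_cases i
    · suffices (√(Fintype.card F : ℝ) : ℂ)⁻¹ +
          (√(Fintype.card F : ℝ) : ℂ)⁻¹ * (Fintype.card F - 1) = √(Fintype.card F : ℝ) by
        simpa [macWilliamsMatrix, Matrix.mulVec, dotProduct]
      field_simp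
      linear_combination -hs
    · simp [macWilliamsMatrix, Matrix.mulVec, dotProduct]
  have h := hC.eval_macWilliamsMatrix_mulVec 1
  rw [hmul, eval_weightEnumerator_zero_right, eval_weightEnumerator_one] at h
  have hpow : (Fintype.card F) ^ N = Fintype.card F ^ (2 * Module.finrank F C) := by
    have := congr($h ^ 2)
    rw [← pow_mul, mul_comm, pow_mul, hs, ← pow_mul, mul_comm] at this
    exact_mod_cast this
  exact (Nat.pow_right_injective Fintype.one_lt_card hpow).symm

theorem IsFormallySelfDual.isDivisibleBy_two (hq : 4 < Fintype.card F) {C : Code F N}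
    (hC : IsFormallySelfDual C) (hdiv : IsDivisible C) : IsDivisibleBy C 2 := by
  rcases eq_or_ne C ⊥ with rfl | hbot
  · rintro c rfl
    simp
  obtain ⟨m, hm, hCm⟩ := hdiv
  obtain ⟨t, ht⟩ := exists_isRoot_weightPolynomial hbot
  have hζ : IsPrimitiveRoot _ m := Complex.isPrimitiveRoot_exp m (by omega)
  obtain ⟨hζ_eq, -⟩ := eq_neg_one_and_sq_add_eq_zero_of_eval_weightEnumerator_eq_zero hq hC
    (by omega) hCm hζ.pow_eq_one (hζ.ne_one hm) (v := ![1, t]) (by simp)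
    (eval_weightPolynomial C t ▸ ht)
  rw [hζ_eq] at hζ
  rwa [hζ.unique (IsPrimitiveRoot.neg_one 0 (by norm_num))] at hCm

theorem IsFormallySelfDual.weightPolynomial_eq (hq : 4 < Fintype.card F) {C : Code F N}
    (hC : IsFormallySelfDual C) (hC2 : IsDivisibleBy C 2) :
    weightPolynomial C = (1 + Polynomial.C (Fintype.card F - 1 : ℂ) * Polynomial.X ^ 2) ^
      Module.finrank F C := by
  obtain ⟨d, hd⟩ : ∃ d : ℕ, weightPolynomial C =
      (1 + Polynomial.C (Fintype.card F - 1 : ℂ) * Polynomial.X ^ 2) ^ d := by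
    refine exists_eq_one_add_C_mul_X_pow_pow two_pos (coeff_zero_weightPolynomial C)
      (fun k hk => ?_) fun t ht => ?_
    · rw [coeff_weightPolynomial, Nat.cast_ne_zero, Finset.card_ne_zero] at hk
      obtain ⟨c, hc⟩ := hk
      obtain ⟨hcC, rfl⟩ := mem_wordsOfWeight.1 hc
      exact hC2 c hcC
    · simpa using (eq_neg_one_and_sq_add_eq_zero_of_eval_weightEnumerator_eq_zero hq hC two_pos hC2
        (ζ := -1) (by norm_num) (by norm_num) (v := ![1, t]) (by simp)
        (eval_weightPolynomial C t ▸ ht)).2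
  have hd_eq : Fintype.card F ^ Module.finrank F C = Fintype.card F ^ d := by
    have h := (eval_weightEnumerator_one C).symm
    rw [show (1 : Fin 2 → ℂ) = ![1, 1] by ext i; fin_cases i <;> rfl, ← eval_weightPolynomial,
      hd] at h
    simp only [map_sub, map_natCast, map_one, Polynomial.eval_pow, Polynomial.eval_add,
      Polynomial.eval_one, Polynomial.eval_mul, Polynomial.eval_sub, Polynomial.eval_natCast,
      Polynomial.eval_X, one_pow, mul_one, add_sub_cancel] at h
    exact_mod_cast h
  rw [hd, Nat.pow_right_injective Fintype.one_lt_card hd_eq]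

theorem IsFormallySelfDual.card_wordsOfWeight_two (hq : 4 < Fintype.card F) {C : Code F N}
    (hC : IsFormallySelfDual C) (hC2 : IsDivisibleBy C 2) :
    (wordsOfWeight C 2).card = Module.finrank F C * (Fintype.card F - 1) := by
  have h := coeff_weightPolynomial C 2
  rw [hC.weightPolynomial_eq hq hC2, coeff_one_add_C_mul_X_pow_pow _ two_pos,
    ← Nat.cast_pred Fintype.card_pos] at h
  exact_mod_cast h.symm

end WeightDistribution

section WeightTwo

variable {F : Type*} [Field F] [Fintype F] [DecidableEq F] {N : ℕ}

theorem IsDivisibleBy.mul_apply_eq_mul_apply (hq : 2 < Fintype.card F) {C : Code F N} {m : ℕ}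
    (hm : m ≠ 1) (hC : IsDivisibleBy C m) {c v : Fin N → F} (hcC : c ∈ C) (hc : hammingNorm c = 2)
    (hv : v ∈ C) {i j : Fin N} (hij : i ≠ j) (hci : c i ≠ 0) (hcj : c j ≠ 0) :
    c i * v j = c j * v i := by
  by_contra hne
  -- Clear position `i` of `v`; then a generic multiple of `c` raises the weight by exactly one.
  let w := c i • v - v i • c
  have hwi : w i = 0 := by simp [w, mul_comm]
  have hwj : w j ≠ 0 := by simpa [w, sub_eq_zero, mul_comm (v i)] using hne
  obtain ⟨a, ha⟩ : ∃ a : F, a ∉ ({0, -(w j / c j)} : Finset F) :=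
    Finset.exists_mem_notMem_of_card_lt_card (s := {0, -(w j / c j)}) (t := Finset.univ)
      (Finset.card_le_two.trans_lt hq) |>.imp fun _ h => h.2
  simp only [Finset.mem_insert, Finset.mem_singleton, not_or] at ha
  have haj : w j + a * c j ≠ 0 := fun h => ha.2 (by field_simp; linear_combination h)
  have hsupport (k : Fin N) : (w + a • c) k ≠ 0 ↔ k = i ∨ w k ≠ 0 := by
    rcases eq_or_ne k i with rfl | hki
    · simp [hwi, ha.1, hci]
    rcases eq_or_ne k j with rfl | hkj
    · simp [hwj, haj]
    · have hck : c k = 0 := by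
        by_contra hck
        exact (eq_or_eq_of_hammingNorm_eq_two hc hij hci hcj hck).elim hki hkj
      simp [hck, hki]
  have hnorm : hammingNorm (w + a • c) = hammingNorm w + 1 := by
    simp only [hammingNorm, hsupport, Finset.filter_or, Finset.filter_eq', Finset.mem_univ,
      if_true, ← Finset.insert_eq]
    exact Finset.card_insert_of_notMem (by simp [hwi])
  have hw : w ∈ C := C.sub_mem (C.smul_mem _ hv) (C.smul_mem _ hcC)
  have hdvd := hC _ (C.add_mem hw (C.smul_mem a hcC))
  rw [hnorm, Nat.dvd_add_right (hC w hw), Nat.dvd_one] at hdvd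
  exact hm hdvd

theorem IsDivisibleBy.card_wordsOfWeight_two_filter_le (hq : 2 < Fintype.card F) {C : Code F N}
    {m : ℕ} (hm : m ≠ 1) (hC : IsDivisibleBy C m) (i : Fin N) :
    ((wordsOfWeight C 2).filter fun c => c i ≠ 0).card ≤ Fintype.card F - 1 := by
  rw [← Finset.card_univ, ← Finset.card_erase_of_mem (Finset.mem_univ (0 : F))]
  refine Finset.card_le_card_of_injOn (fun c => c i) (fun c hc => by simp_all) ?_
  intro c hc d hd (hcd : c i = d i)
  simp only [Finset.coe_filter, mem_wordsOfWeight, Set.mem_ofPred_eq] at hc hd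
  obtain ⟨⟨hcC, hc⟩, hci⟩ := hc
  obtain ⟨⟨hdC, hd⟩, hdi⟩ := hd
  obtain ⟨j, hji, hcj⟩ := exists_ne_of_hammingNorm_eq_two hc i
  have hdj : d j = c j := by
    have := hC.mul_apply_eq_mul_apply hq hm hcC hc hdC hji.symm hci hcj
    rw [← hcd, mul_comm] at this
    exact mul_right_cancel₀ hci this
  ext k
  by_cases hk : k = i ∨ k = j
  · rcases hk with rfl | rfl
    exacts [hcd, hdj.symm]
  · rw [not_imp_comm.1 (eq_or_eq_of_hammingNorm_eq_two hc hji.symm hci hcj) hk,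
      not_imp_comm.1 (eq_or_eq_of_hammingNorm_eq_two hd hji.symm hdi (hdj ▸ hcj)) hk]

theorem sum_card_wordsOfWeight_filter (C : Code F N) (k : ℕ) :
    ∑ i, ((wordsOfWeight C k).filter fun c => c i ≠ 0).card = (wordsOfWeight C k).card * k := by
  rw [← Finset.sum_const_nat fun c hc => (mem_wordsOfWeight.1 hc).2]
  exact (Finset.sum_card_bipartiteAbove_eq_sum_card_bipartiteBelow
    fun (c : Fin N → F) i => c i ≠ 0).symm

theorem IsDivisibleBy.exists_mem_wordsOfWeight_two (hq : 2 < Fintype.card F) {C : Code F N}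
    {m : ℕ} (hm : m ≠ 1) (hC : IsDivisibleBy C m)
    (hcard : N * (Fintype.card F - 1) ≤ (wordsOfWeight C 2).card * 2) (i : Fin N) :
    ∃ c ∈ wordsOfWeight C 2, c i ≠ 0 := by
  by_contra! hno
  refine hcard.not_gt ?_
  calc (wordsOfWeight C 2).card * 2
      = ∑ k, ((wordsOfWeight C 2).filter fun c => c k ≠ 0).card :=
        (sum_card_wordsOfWeight_filter C 2).symm
    _ < ∑ _k : Fin N, (Fintype.card F - 1) := by
        refine Finset.sum_lt_sum (fun k _ => hC.card_wordsOfWeight_two_filter_le hq hm k)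
          ⟨i, Finset.mem_univ i, ?_⟩
        rw [Finset.filter_eq_empty_iff.2 fun c hc => not_not.2 (hno c hc), Finset.card_empty]
        omega
    _ = N * (Fintype.card F - 1) := by simp

theorem IsDivisibleBy.exists_pairing (hq : 2 < Fintype.card F) {C : Code F N}
    {m : ℕ} (hm : m ≠ 1) (hC : IsDivisibleBy C m)
    (hcard : N * (Fintype.card F - 1) ≤ (wordsOfWeight C 2).card * 2) :
    ∃ τ : Equiv.Perm (Fin N), τ ^ 2 = 1 ∧ (∀ i, τ i ≠ i) ∧
      ∃ s : Fin N → Fˣ, ∀ v ∈ C, ∀ i, v (τ i) = s i * v i := by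
  choose c hcC hci using hC.exists_mem_wordsOfWeight_two hq hm hcard
  simp only [mem_wordsOfWeight] at hcC
  choose τ hτ_ne hcτ using fun i => exists_ne_of_hammingNorm_eq_two (hcC i).2 i
  let s (i : Fin N) : Fˣ := Units.mk0 _ (hcτ i) / Units.mk0 _ (hci i)
  have hs (v : Fin N → F) (hv : v ∈ C) (i : Fin N) : v (τ i) = s i * v i := by
    have := hC.mul_apply_eq_mul_apply hq hm (hcC i).1 (hcC i).2 hv (hτ_ne i).symm (hci i) (hcτ i)
    simp only [s, Units.val_div_eq_div_val, Units.val_mk0]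
    rw [div_mul_eq_mul_div, eq_div_iff (hci i), mul_comm, this]
  have hτ : Function.Involutive τ := fun i => by
    have : c i (τ (τ i)) ≠ 0 := by
      rw [hs _ (hcC i).1]
      exact mul_ne_zero (s (τ i)).ne_zero (hcτ i)
    exact (eq_or_eq_of_hammingNorm_eq_two (hcC i).2 (hτ_ne i).symm (hci i) (hcτ i)
      this).resolve_right (hτ_ne _)
  exact ⟨hτ.toPerm, Equiv.ext fun i => by simp [sq, hτ i], hτ_ne, s, hs⟩

end WeightTwo

section DirectSum

variable {F : Type*} [Field F]

theorem monomialMap_apply {N : ℕ} (d : Fin N → Fˣ) (σ : Equiv.Perm (Fin N)) (v : Fin N → F)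
    (i : Fin N) : monomialMap d σ v i = d i * v (σ i) := by
  rw [monomialMap, Matrix.mulVecLin_apply, ← Matrix.mulVec_mulVec, Matrix.mulVec_diagonal,
    Matrix.permMatrix_mulVec, Function.comp_apply]

theorem monomialMap_injective {N : ℕ} (d : Fin N → Fˣ) (σ : Equiv.Perm (Fin N)) :
    Function.Injective (monomialMap d σ) := by
  intro v w h
  ext i
  simpa [monomialMap_apply] using congrFun h (σ.symm i)

/-- The bijection sending the pair `(i, j)` to position `j` of the `i`-th block of length `k`. -/
def blockEquiv (k n : ℕ) : Fin n × Fin k ≃ Fin (k * n) :=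
  finProdFinEquiv.trans (finCongr (mul_comm n k))

theorem blockEquiv_apply (k n : ℕ) (i : Fin n) (j : Fin k) :
    blockEquiv k n (i, j) = block k n i j := by
  ext
  simp [blockEquiv, block, add_comm]

theorem blockEquiv_symm_block (k n : ℕ) (i : Fin n) (j : Fin k) :
    (blockEquiv k n).symm (block k n i j) = (i, j) := by
  rw [← blockEquiv_apply, Equiv.symm_apply_apply]

/-- The involution of `Fin (2 * n)` exchanging the two positions of each block of length two. -/
def blockSwap (n : ℕ) : Equiv.Perm (Fin (2 * n)) :=
  (blockEquiv 2 n).permCongr ((Equiv.refl (Fin n)).prodCongr (Equiv.swap 0 1))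

theorem blockSwap_block (n : ℕ) (i : Fin n) (j : Fin 2) :
    blockSwap n (block 2 n i j) = block 2 n i (Equiv.swap 0 1 j) := by
  simp [blockSwap, ← blockEquiv_apply]

theorem blockSwap_sq (n : ℕ) : blockSwap n ^ 2 = 1 := by
  refine Equiv.ext fun p => ?_
  obtain ⟨⟨i, j⟩, rfl⟩ := (blockEquiv 2 n).surjective p
  simp [sq, blockEquiv_apply, blockSwap_block]

theorem blockSwap_apply_ne (n : ℕ) (p : Fin (2 * n)) : blockSwap n p ≠ p := by
  obtain ⟨⟨i, j⟩, rfl⟩ := (blockEquiv 2 n).surjective p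
  rw [blockEquiv_apply, blockSwap_block, ← blockEquiv_apply, ← blockEquiv_apply,
    (blockEquiv 2 n).injective.ne_iff]
  fin_cases j <;> simp

theorem mem_directSumCopies {k n : ℕ} {C : Code F k} {v : Fin (k * n) → F} :
    v ∈ directSumCopies C n ↔ ∀ i, v ∘ block k n i ∈ C := by
  simp [directSumCopies, LinearMap.funLeft]

/-- A word of a direct sum of copies of `C` is a family of words of `C`, one for each block. -/
def directSumCopiesEquiv {k : ℕ} (C : Code F k) (n : ℕ) :
    directSumCopies C n ≃ₗ[F] (Fin n → C) where
  toFun v i := ⟨v ∘ block k n i, mem_directSumCopies.1 v.2 i⟩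
  invFun w := ⟨fun p => (w ((blockEquiv k n).symm p).1 : Fin k → F) ((blockEquiv k n).symm p).2,
    mem_directSumCopies.2 fun i => by
      simp [Function.comp_def, blockEquiv_symm_block]⟩
  left_inv v := by
    ext p
    simp [← blockEquiv_apply]
  right_inv w := by
    ext i j
    simp [blockEquiv_symm_block]
  map_add' _ _ := rfl
  map_smul' _ _ := rfl

theorem finrank_directSumCopies {k : ℕ} (C : Code F k) (n : ℕ) :
    Module.finrank F (directSumCopies C n) = n * Module.finrank F C := by
  simp [(directSumCopiesEquiv C n).finrank_eq, Module.finrank_pi_fintype]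

theorem finrank_repetitionTwo : Module.finrank F (repetitionTwo F) = 1 :=
  finrank_span_singleton (by simp)

theorem mem_repetitionTwo {v : Fin 2 → F} : v ∈ repetitionTwo F ↔ v 0 = v 1 := by
  rw [repetitionTwo, Submodule.mem_span_singleton]
  refine ⟨?_, fun h => ⟨v 0, ?_⟩⟩
  · rintro ⟨a, rfl⟩
    simp
  · ext i
    fin_cases i <;> simp [h]

theorem isEquivalent_directSumCopies_repetitionTwo {n : ℕ} {C : Code F (2 * n)}
    (hn : n ≤ Module.finrank F C) {τ : Equiv.Perm (Fin (2 * n))} (hτ : τ ^ 2 = 1)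
    (hτ_ne : ∀ i, τ i ≠ i) (s : Fin (2 * n) → Fˣ) (hs : ∀ v ∈ C, ∀ i, v (τ i) = s i * v i) :
    IsEquivalent C (directSumCopies (repetitionTwo F) n) := by
  obtain ⟨g, rfl⟩ := isConj_iff.1 (isConj_of_sq_eq_one_of_forall_apply_ne
    (blockSwap_sq n) hτ (blockSwap_apply_ne n) hτ_ne)
  let d (p : Fin (2 * n)) : Fˣ := if ((blockEquiv 2 n).symm p).2 = 0 then s (g p) else 1
  refine ⟨d, g, (Submodule.eq_of_le_of_finrank_le ?_ ?_).symm⟩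
  · rintro _ ⟨v, hv, rfl⟩
    refine mem_directSumCopies.2 fun i => mem_repetitionTwo.2 ?_
    have h : v (g (block 2 n i 1)) = s (g (block 2 n i 0)) * v (g (block 2 n i 0)) := by
      simpa [blockSwap_block] using hs v hv (g (block 2 n i 0))
    simp only [Function.comp_apply, monomialMap_apply, h]
    simp [d, blockEquiv_symm_block]
  · rwa [← (Submodule.equivMapOfInjective _ (monomialMap_injective d g) C).finrank_eq,
      finrank_directSumCopies, finrank_repetitionTwo, mul_one]

end DirectSum

end LinearCodes

theorem mainTheorem4 {F : Type*} [Field F] [Fintype F] [DecidableEq F]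
    (hq : 4 < Fintype.card F) (n : ℕ) (C : LinearCodes.Code F (2 * n))
    (hfsd : LinearCodes.IsFormallySelfDual C) (hdiv : LinearCodes.IsDivisible C) :
    LinearCodes.IsEquivalent C
      (LinearCodes.directSumCopies (LinearCodes.repetitionTwo F) n) := by
  have heven : LinearCodes.IsDivisibleBy C 2 := hfsd.isDivisibleBy_two hq hdiv
  have hdim : Module.finrank F C = n :=
    Nat.eq_of_mul_eq_mul_left two_pos hfsd.two_mul_finrank_eq
  have hcard : (LinearCodes.wordsOfWeight C 2).card = n * (Fintype.card F - 1) := by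
    rw [hfsd.card_wordsOfWeight_two hq heven, hdim]
  obtain ⟨τ, hτ, hτ_ne, s, hs⟩ := heven.exists_pairing (by omega) (by norm_num)
    (hcard ▸ (by ring : 2 * n * (Fintype.card F - 1) = n * (Fintype.card F - 1) * 2).le)
  exact LinearCodes.isEquivalent_directSumCopies_repetitionTwo hdim.ge hτ hτ_ne s hs
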